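/- For real $L$ and $\kappa>0$, call a unit vector $v\in\mathbb{S}^{N-1}\subset\mathbb{R}^N$ $(L,\kappa)$-delocalized if $\sum_{j\in A}v_j^2\le\kappa^2$ for every set $A\subseteq\{1,\dots,N\}$ with $|A|\le L$, and let $D_{L,\kappa}\subseteq\mathbb{S}^{N-1}$ be the set of all such vectors. For each $N\ge 1$ let $V_N$ be a random vector uniformly distributed on $\mathbb{S}^{N-1}$. There exist universal constants $c_1,c_2>0$ such that for every $0<\kappa<1$ independent of $N$ and every sequence of real numbers $(\nu_N)$ (in particular every constant sequence $\nu_N=\nu$), the following hold as $N\to\infty$. a. If $\nu_N\le\dfrac{c_1\kappa^2}{\log(e/\kappa)}$ for all $N$, then $\mathbf{P}[V_N\in D_{\nu_N N,\kappa}]=1-o(1)$. b. If $\nu_N\ge\dfrac{c_2\kappa^2}{\log(e/\kappa)}$ for all $N$, then $\mathbf{P}[V_N\in D_{\nu_N N,\kappa}]=o(1)$. -/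

import Mathlib

open MeasureTheory ProbabilityTheory Filter Topology

/-- The set `D_{L,κ}` of `(L,κ)`-delocalized unit vectors of `ℝ^N`: for every set `A` of at most
`L` coordinates, `∑_{j ∈ A} v_j² ≤ κ²`. Here `L` is a real number. -/
def delocalizedSet (N : ℕ) (L κ : ℝ) : Set (EuclideanSpace ℝ (Fin N)) :=
  {v | v ∈ Metric.sphere (0 : EuclideanSpace ℝ (Fin N)) 1 ∧
    ∀ A : Finset (Fin N), (A.card : ℝ) ≤ L → ∑ j ∈ A, |v j| ^ 2 ≤ κ ^ 2}

/-- The uniform distribution on the unit sphere of `ℝ^N` (`N ≥ 1`), as a measure on `ℝ^N`: the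
surface measure of the sphere, normalized to have total mass one. -/
noncomputable def uniformSphere (N : ℕ) : Measure (EuclideanSpace ℝ (Fin N)) :=
  let σ := (volume : Measure (EuclideanSpace ℝ (Fin N))).toSphere
  ((σ Set.univ)⁻¹ • σ).map Subtype.val

/-!
Normalizing a standard Gaussian vector of `ℝ^N` gives a uniform point of the sphere, so all the
`V_N` can be read off one sequence `x` of independent Gaussians. By the law of large numbers the
first `N` terms have squared norm about `N`, of which the terms with `x_i² > t` carry about
`N F(t)`, where `F(t) = E[x₁²; x₁² > t]`.

A set of at most `ν N` coordinates carries at most `ν N t` outside these large terms, so the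
direction is delocalized as soon as `ν t + F(t) < κ²`. Conversely it is localized as soon as
`κ² < F(t)` and `κ² < ν t`: either the large terms are at most `ν N` in number and together too
heavy, or about `ν N` of them already carry more than `ν N t`. Since `F(t)` lies between multiples
of `t e^{-t}` and `e^{-t/8}`, both regimes are reached with `t` a multiple of `log (e / κ)`, that
is, with `ν` of order `κ² / log (e / κ)`.
-/

section Polar

variable {E : Type*} [NormedAddCommGroup E] [MeasurableSpace E] [BorelSpace E]

theorem measurable_normalize [NormedSpace ℝ E] [SecondCountableTopology E] :
    Measurable (NormedSpace.normalize : E → E) := by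
  unfold NormedSpace.normalize
  fun_prop

theorem withDensity_norm_normalize_preimage [NormedSpace ℝ E] [FiniteDimensional ℝ E]
    [Nontrivial E] (μ : Measure E) [μ.IsAddHaarMeasure] {f : ℝ → ENNReal} (hf : Measurable f)
    {S : Set E} (hS : MeasurableSet S) :
    μ.withDensity (fun x => f ‖x‖) (NormedSpace.normalize ⁻¹' S) =
      μ.toSphere (Subtype.val ⁻¹' S) *
        ∫⁻ r, f r.1 ∂(Measure.volumeIoiPow (Module.finrank ℝ E - 1)) := by
  have hS' : MeasurableSet (NormedSpace.normalize ⁻¹' S) := measurable_normalize hS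
  calc μ.withDensity (fun x => f ‖x‖) (NormedSpace.normalize ⁻¹' S)
      = ∫⁻ x, (NormedSpace.normalize ⁻¹' S).indicator (fun x => f ‖x‖) x ∂μ := by
        rw [withDensity_apply _ hS', lintegral_indicator hS']
    _ = ∫⁻ x : ({0}ᶜ : Set E), (NormedSpace.normalize ⁻¹' S).indicator (fun x => f ‖x‖) x.1
          ∂(μ.comap (↑)) := by
        rw [lintegral_subtype_comap (measurableSet_singleton _).compl, restrict_compl_singleton]
    _ = ∫⁻ p, (Subtype.val ⁻¹' S).indicator 1 p.1 * f p.2.1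
          ∂(μ.toSphere.prod (Measure.volumeIoiPow (Module.finrank ℝ E - 1))) := by
        rw [← μ.measurePreserving_homeomorphUnitSphereProd.lintegral_comp_emb
          (Homeomorph.measurableEmbedding _)]
        refine lintegral_congr fun x => ?_
        by_cases h : ‖x.1‖⁻¹ • x.1 ∈ S <;> simp [NormedSpace.normalize, Set.indicator, h]
    _ = _ := by
        have hS_sphere : MeasurableSet ((↑) ⁻¹' S : Set (Metric.sphere (0 : E) 1)) :=
          measurable_subtype_coe hS
        rw [lintegral_prod_mul (measurable_one.indicator hS_sphere).aemeasurable
          (g := fun r : Set.Ioi (0 : ℝ) => f r.1) (hf.comp measurable_subtype_coe).aemeasurable,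
          lintegral_indicator_one hS_sphere]

theorem map_normalize_withDensity_norm [NormedSpace ℝ E] [FiniteDimensional ℝ E] [Nontrivial E]
    (μ : Measure E) [μ.IsAddHaarMeasure] {f : ℝ → ENNReal} (hf : Measurable f)
    [IsProbabilityMeasure (μ.withDensity (fun x => f ‖x‖))] :
    (μ.withDensity (fun x => f ‖x‖)).map NormedSpace.normalize =
      ((μ.toSphere Set.univ)⁻¹ • μ.toSphere).map Subtype.val := by
  have hmass := withDensity_norm_normalize_preimage μ hf MeasurableSet.univ
  rw [Set.preimage_univ, Set.preimage_univ, measure_univ, mul_comm] at hmass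
  ext S hS
  rw [Measure.map_apply measurable_normalize hS, Measure.map_apply measurable_subtype_coe hS,
    withDensity_norm_normalize_preimage μ hf hS, ENNReal.eq_inv_of_mul_eq_one_left hmass.symm,
    Measure.smul_apply, smul_eq_mul, mul_comm]

variable [InnerProductSpace ℝ E] [FiniteDimensional ℝ E]

theorem stdGaussian_eq_withDensity :
    stdGaussian E = volume.withDensity fun x =>
      ENNReal.ofReal (((2 * Real.pi) ^ (Module.finrank ℝ E / 2 : ℝ))⁻¹ *
        Real.exp (-(1 / 2) * ‖x‖ ^ 2)) := by
  set c : ℝ := ((2 * Real.pi) ^ (Module.finrank ℝ E / 2 : ℝ))⁻¹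
  have hint : Integrable fun x : E => c * Real.exp (-(1 / 2) * ‖x‖ ^ 2) := by
    refine Integrable.const_mul (Integrable.of_integral_ne_zero ?_) c
    rw [GaussianFourier.integral_rexp_neg_mul_sq_norm (by norm_num)]
    positivity
  have : IsFiniteMeasure
      (volume.withDensity fun x : E => ENNReal.ofReal (c * Real.exp (-(1 / 2) * ‖x‖ ^ 2))) :=
    isFiniteMeasure_withDensity_ofReal hint.2
  refine Measure.ext_of_charFun (funext fun t => ?_)
  rw [charFun_stdGaussian, charFun_apply,
    integral_withDensity_eq_integral_toReal_smul (by fun_prop) (by simp)]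
  have hfourier := GaussianFourier.integral_cexp_neg_mul_sq_norm_add
    (b := 1 / 2) (by norm_num) Complex.I t
  have hcomplex : (c : ℂ) * (Real.pi / (1 / 2)) ^ (Module.finrank ℝ E / 2 : ℂ) = 1 := by
    have hbase : (Real.pi / (1 / 2) : ℂ) = ((2 * Real.pi : ℝ) : ℂ) := by push_cast; ring
    have hdim : (Module.finrank ℝ E / 2 : ℂ) = ((Module.finrank ℝ E / 2 : ℝ) : ℂ) := by simp
    rw [hbase, hdim, ← Complex.ofReal_cpow (by positivity), ← Complex.ofReal_mul,
      inv_mul_cancel₀ (by positivity), Complex.ofReal_one]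
  calc Complex.exp (-‖t‖ ^ 2 / 2)
      = c * ∫ x : E, Complex.exp (-(1 / 2) * ‖x‖ ^ 2 + Complex.I * inner ℝ t x) := by
        rw [hfourier, ← mul_assoc, hcomplex, one_mul, Complex.I_sq]
        ring_nf
    _ = _ := by
        rw [← integral_const_mul]
        refine integral_congr_ae (ae_of_all _ fun x => ?_)
        dsimp only
        rw [ENNReal.toReal_ofReal (by positivity), Complex.real_smul, Complex.exp_add,
          real_inner_comm]
        push_cast
        ring_nf

theorem map_normalize_stdGaussian [Nontrivial E] :
    (stdGaussian E).map NormedSpace.normalize =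
      (((volume : Measure E).toSphere Set.univ)⁻¹ • (volume : Measure E).toSphere).map
        Subtype.val := by
  let f (r : ℝ) : ENNReal := ENNReal.ofReal
    (((2 * Real.pi) ^ (Module.finrank ℝ E / 2 : ℝ))⁻¹ * Real.exp (-(1 / 2) * r ^ 2))
  have hdensity : stdGaussian E = volume.withDensity fun x => f ‖x‖ := stdGaussian_eq_withDensity
  have : IsProbabilityMeasure ((volume : Measure E).withDensity fun x => f ‖x‖) :=
    hdensity ▸ inferInstance
  rw [hdensity, map_normalize_withDensity_norm volume (by fun_prop)]

end Polar

section RandomSequences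

theorem ae_tendsto_average_infinitePi {α : Type*} [MeasurableSpace α] {μ : Measure α}
    [IsProbabilityMeasure μ] {f : α → ℝ} (hf : Measurable f) (hint : Integrable f μ) :
    ∀ᵐ x ∂(Measure.infinitePi fun _ : ℕ => μ),
      Tendsto (fun n : ℕ => (∑ i ∈ Finset.range n, f (x i)) / n) atTop (𝓝 (∫ y, f y ∂μ)) := by
  set P := Measure.infinitePi fun _ : ℕ => μ
  have heval (i : ℕ) : MeasurePreserving (fun x : ℕ → α => x i) P μ :=
    measurePreserving_eval_infinitePi (fun _ : ℕ => μ) i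
  have hindep : iIndepFun (fun i (x : ℕ → α) => f (x i)) P :=
    iIndepFun_infinitePi (X := fun _ => f) fun _ => hf
  have hident (i : ℕ) : IdentDistrib (fun x : ℕ → α => f (x i)) (fun x => f (x 0)) P P :=
    ((heval i).hasLaw.identDistrib (heval 0).hasLaw).comp hf
  have hmean : ∫ x : ℕ → α, f (x 0) ∂P = ∫ y, f y ∂μ :=
    (heval 0).hasLaw.integral_comp hf.aestronglyMeasurable
  rw [← hmean]
  exact strong_law_ae_real (fun i (x : ℕ → α) => f (x i))
    ((heval 0).integrable_comp_of_integrable hint) (fun _ _ hij => hindep.indepFun hij) hident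

variable {Ω ι : Type*} [MeasurableSpace Ω] {μ : Measure Ω} {l : Filter ι}
  [l.IsCountablyGenerated] {S : ι → Set Ω}

theorem tendsto_measureReal_one_of_ae_eventually_mem [IsProbabilityMeasure μ]
    (hS : ∀ i, MeasurableSet (S i)) (h : ∀ᵐ ω ∂μ, ∀ᶠ i in l, ω ∈ S i) :
    Tendsto (fun i => μ.real (S i)) l (𝓝 1) := by
  have hlim : Tendsto (fun i => μ (S i)) l (𝓝 (μ Set.univ)) :=
    tendsto_measure_of_ae_tendsto_indicator_of_isFiniteMeasure l MeasurableSet.univ hS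
      (by simpa using h)
  simpa [Function.comp_def, Measure.real] using
    (ENNReal.tendsto_toReal (measure_ne_top μ Set.univ)).comp hlim

theorem tendsto_measureReal_zero_of_ae_eventually_notMem [IsFiniteMeasure μ]
    (hS : ∀ i, MeasurableSet (S i)) (h : ∀ᵐ ω ∂μ, ∀ᶠ i in l, ω ∉ S i) :
    Tendsto (fun i => μ.real (S i)) l (𝓝 0) := by
  have hlim : Tendsto (fun i => μ (S i)) l (𝓝 (μ ∅)) :=
    tendsto_measure_of_ae_tendsto_indicator_of_isFiniteMeasure l MeasurableSet.empty hS
      (by simpa using h)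
  simpa [Function.comp_def, Measure.real] using
    (ENNReal.tendsto_toReal (measure_ne_top μ ∅)).comp hlim

end RandomSequences

section GaussianSequence

/-- The first `N` terms of a real sequence, as a vector of `ℝ^N`. It couples the random vectors of
all dimensions: they are read off one infinite sequence of independent Gaussians. -/
def initialVector (N : ℕ) (x : ℕ → ℝ) : EuclideanSpace ℝ (Fin N) :=
  WithLp.toLp 2 fun i => x i

theorem sum_initialVector {M : Type*} [AddCommMonoid M] (N : ℕ) (x : ℕ → ℝ) (f : ℝ → M) :
    ∑ j, f (initialVector N x j) = ∑ i ∈ Finset.range N, f (x i) :=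
  (Finset.sum_range fun i => f (x i)).symm

theorem norm_sq_initialVector (N : ℕ) (x : ℕ → ℝ) :
    ‖initialVector N x‖ ^ 2 = ∑ i ∈ Finset.range N, x i ^ 2 := by
  rw [EuclideanSpace.real_norm_sq_eq, sum_initialVector N x (· ^ 2)]

theorem measurable_initialVector (N : ℕ) : Measurable (initialVector N) := by
  unfold initialVector
  fun_prop

theorem map_initialVector_infinitePi_gaussianReal (N : ℕ) :
    (Measure.infinitePi fun _ : ℕ => gaussianReal 0 1).map (initialVector N) =
      stdGaussian (EuclideanSpace ℝ (Fin N)) := by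
  have hrestrict := Measure.map_infinitePi_infinitePi_of_inj
    (P := fun _ : ℕ => gaussianReal 0 1) (Fin.val_injective (n := N))
  rw [← map_pi_eq_stdGaussian, ← Measure.infinitePi_eq_pi, ← hrestrict,
    Measure.map_map (by fun_prop) (by fun_prop)]
  rfl

theorem hasLaw_normalize_initialVector {N : ℕ} (hN : 1 ≤ N) :
    HasLaw (fun x => NormedSpace.normalize (initialVector N x)) (uniformSphere N)
      (Measure.infinitePi fun _ : ℕ => gaussianReal 0 1) where
  aemeasurable := (measurable_normalize.comp (measurable_initialVector N)).aemeasurable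
  map_eq := by
    have : Nonempty (Fin N) := ⟨⟨0, hN⟩⟩
    calc Measure.map _ _
        = (stdGaussian (EuclideanSpace ℝ (Fin N))).map NormedSpace.normalize := by
          rw [← map_initialVector_infinitePi_gaussianReal,
            Measure.map_map measurable_normalize (measurable_initialVector N)]
          rfl
      _ = uniformSphere N := map_normalize_stdGaussian

theorem integrable_sq_gaussianReal (m : ℝ) (v : NNReal) :
    Integrable (fun x : ℝ => x ^ 2) (gaussianReal m v) :=
  (memLp_id_gaussianReal 2).integrable_sq

theorem integral_sq_gaussianReal (m : ℝ) (v : NNReal) :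
    ∫ x, x ^ 2 ∂(gaussianReal m v) = m ^ 2 + v := by
  have h := variance_eq_sub (memLp_id_gaussianReal (μ := m) (v := v) 2)
  simp only [variance_id_gaussianReal, Pi.pow_apply, id_eq, integral_id_gaussianReal] at h
  linarith

end GaussianSequence

section TailSq

/-- The square function, cut off below the level `t`. Truncation at `t` separates the large
coordinates of a vector, which carry its localized mass, from the small ones. -/
noncomputable def tailSq (t : ℝ) : ℝ → ℝ :=
  {x | t < x ^ 2}.indicator fun x => x ^ 2

variable {t : ℝ}

theorem tailSq_nonneg (t x : ℝ) : 0 ≤ tailSq t x :=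
  Set.indicator_nonneg (fun _ _ => sq_nonneg _) x

theorem sq_le_add_tailSq (ht : 0 ≤ t) (x : ℝ) : x ^ 2 ≤ t + tailSq t x := by
  by_cases h : t < x ^ 2
  · simp [tailSq, h, ht]
  · simp [tailSq, h, not_lt.1 h]

theorem measurableSet_lt_sq (t : ℝ) : MeasurableSet {x : ℝ | t < x ^ 2} :=
  measurableSet_lt measurable_const (by fun_prop)

theorem measurable_tailSq (t : ℝ) : Measurable (tailSq t) :=
  Measurable.indicator (by fun_prop) (measurableSet_lt_sq t)

theorem integrable_tailSq {μ : Measure ℝ} (hμ : Integrable (fun x => x ^ 2) μ) (t : ℝ) :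
    Integrable (tailSq t) μ :=
  hμ.indicator (measurableSet_lt_sq t)

theorem mul_measureReal_le_integral_tailSq {μ : Measure ℝ} [IsFiniteMeasure μ]
    (hμ : Integrable (fun x => x ^ 2) μ) (t : ℝ) :
    t * μ.real {x | t < x ^ 2} ≤ ∫ x, tailSq t x ∂μ := by
  calc t * μ.real {x | t < x ^ 2} ≤ ∫ x in {x | t < x ^ 2}, x ^ 2 ∂μ :=
        setIntegral_ge_of_const_le_real (measurableSet_lt_sq t) (measure_ne_top _ _)
          (fun _ hx => le_of_lt hx) hμ.integrableOn
    _ = ∫ x, tailSq t x ∂μ := (integral_indicator (measurableSet_lt_sq t)).symm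

theorem tailSq_le_exp_mul_exp {s : ℝ} (hs : 0 < s) (t x : ℝ) :
    tailSq t x ≤ s⁻¹ * Real.exp (-(s * t)) * Real.exp (2 * s * x ^ 2) := by
  refine Set.indicator_apply_le' (fun hx : t < x ^ 2 => ?_) fun _ => by positivity
  have hlin : s * x ^ 2 ≤ Real.exp (s * x ^ 2) := by linarith [Real.add_one_le_exp (s * x ^ 2)]
  calc x ^ 2 = s⁻¹ * (s * x ^ 2) := (inv_mul_cancel_left₀ hs.ne' _).symm
    _ ≤ s⁻¹ * Real.exp (s * x ^ 2) := by gcongr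
    _ ≤ s⁻¹ * Real.exp (-(s * t) + 2 * s * x ^ 2) := by
        gcongr
        linarith [mul_lt_mul_of_pos_left hx hs]
    _ = _ := by rw [Real.exp_add, ← mul_assoc]

theorem gaussianPDFReal_mul_exp_mul_sq (b x : ℝ) :
    gaussianPDFReal 0 1 x * Real.exp (b * x ^ 2) =
      (√(2 * Real.pi))⁻¹ * Real.exp (-(1 / 2 - b) * x ^ 2) := by
  rw [gaussianPDFReal, mul_assoc, ← Real.exp_add, NNReal.coe_one]
  ring_nf

theorem integral_exp_mul_sq_gaussianReal {b : ℝ} (hb : b < 1 / 2) :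
    ∫ x, Real.exp (b * x ^ 2) ∂(gaussianReal 0 1) = (√(1 - 2 * b))⁻¹ := by
  simp only [integral_gaussianReal_eq_integral_smul one_ne_zero, smul_eq_mul,
    gaussianPDFReal_mul_exp_mul_sq, integral_const_mul, integral_gaussian]
  rw [← Real.sqrt_inv, ← Real.sqrt_inv, ← Real.sqrt_mul (by positivity)]
  congr 1
  have : 1 - 2 * b ≠ 0 := by linarith
  have : 1 / 2 - b ≠ 0 := by linarith
  field_simp

theorem integrable_exp_mul_sq_gaussianReal {b : ℝ} (hb : b < 1 / 2) :
    Integrable (fun x => Real.exp (b * x ^ 2)) (gaussianReal 0 1) := by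
  refine Integrable.of_integral_ne_zero ?_
  rw [integral_exp_mul_sq_gaussianReal hb]
  have : 0 < 1 - 2 * b := by linarith
  positivity

theorem integral_tailSq_gaussianReal_le {s : ℝ} (hs : 0 < s) (hs' : s < 1 / 4) (t : ℝ) :
    ∫ x, tailSq t x ∂(gaussianReal 0 1) ≤
      s⁻¹ * Real.exp (-(s * t)) * (√(1 - 4 * s))⁻¹ := by
  have hb : 2 * s < 1 / 2 := by linarith
  calc ∫ x, tailSq t x ∂(gaussianReal 0 1)
      ≤ ∫ x, s⁻¹ * Real.exp (-(s * t)) * Real.exp (2 * s * x ^ 2) ∂(gaussianReal 0 1) :=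
        integral_mono (integrable_tailSq (integrable_sq_gaussianReal 0 1) t)
          ((integrable_exp_mul_sq_gaussianReal hb).const_mul _) (tailSq_le_exp_mul_exp hs t)
    _ = _ := by
        rw [integral_const_mul, integral_exp_mul_sq_gaussianReal hb]
        ring_nf

theorem exp_neg_div_three_le_gaussianPDFReal {r x : ℝ} (hx : x ^ 2 ≤ 2 * r) :
    Real.exp (-r) / 3 ≤ gaussianPDFReal 0 1 x := by
  have hsqrt : √(2 * Real.pi) ≤ 3 :=
    Real.sqrt_le_iff.2 ⟨by norm_num, by linarith [Real.pi_lt_d2]⟩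
  calc Real.exp (-r) / 3 = 3⁻¹ * Real.exp (-r) := by ring
    _ ≤ (√(2 * Real.pi))⁻¹ * Real.exp (-(x ^ 2) / 2) := by
        gcongr
        linarith
    _ = gaussianPDFReal 0 1 x := by simp [gaussianPDFReal]

theorem exp_neg_div_three_le_gaussianReal_real_lt_sq (ht : 0 ≤ t) :
    Real.exp (-(t + 1)) / 3 ≤ (gaussianReal 0 1).real {x | t < x ^ 2} := by
  have hpdf : ∀ x ∈ Set.Ioo (√t) (√t + 1),
      Real.exp (-(t + 1)) / 3 ≤ gaussianPDFReal 0 1 x := by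
    rintro x ⟨hlt, hgt⟩
    refine exp_neg_div_three_le_gaussianPDFReal ?_
    nlinarith [Real.sqrt_nonneg t, Real.sq_sqrt ht, sq_nonneg (√t - 1)]
  calc Real.exp (-(t + 1)) / 3 ≤ ∫ x in Set.Ioo (√t) (√t + 1), gaussianPDFReal 0 1 x := by
        simpa using setIntegral_ge_of_const_le_real (μ := volume) measurableSet_Ioo (by simp) hpdf
          (integrable_gaussianPDFReal 0 1).integrableOn
    _ = (gaussianReal 0 1).real (Set.Ioo (√t) (√t + 1)) := by
        rw [measureReal_def, gaussianReal_apply_eq_integral 0 one_ne_zero,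
          ENNReal.toReal_ofReal (integral_nonneg fun x => gaussianPDFReal_nonneg 0 1 x)]
    _ ≤ (gaussianReal 0 1).real {x | t < x ^ 2} :=
        measureReal_mono fun x hx => Real.lt_sq_of_sqrt_lt hx.1

theorem mul_exp_neg_div_three_le_integral_tailSq_gaussianReal (ht : 0 ≤ t) :
    t * (Real.exp (-(t + 1)) / 3) ≤ ∫ x, tailSq t x ∂(gaussianReal 0 1) :=
  (mul_le_mul_of_nonneg_left (exp_neg_div_three_le_gaussianReal_real_lt_sq ht) ht).trans
    (mul_measureReal_le_integral_tailSq (integrable_sq_gaussianReal 0 1) t)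

end TailSq

section Delocalized

variable {N : ℕ} {L κ t : ℝ}

theorem isClosed_delocalizedSet (N : ℕ) (L κ : ℝ) : IsClosed (delocalizedSet N L κ) := by
  simp only [delocalizedSet, Set.ofPred_and, Set.ofPred_forall]
  exact Metric.isClosed_sphere.inter <| isClosed_iInter fun A => isClosed_iInter fun _ =>
    isClosed_le (by fun_prop) continuous_const

theorem delocalizedSet_eq_empty (hκ : κ ^ 2 < 1) (hL : N ≤ L) : delocalizedSet N L κ = ∅ := by
  refine Set.eq_empty_of_forall_notMem fun v ⟨hv, hA⟩ => ?_
  have hmass : ∑ j, |v j| ^ 2 = 1 := by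
    simpa [mem_sphere_zero_iff_norm.1 hv] using (EuclideanSpace.norm_sq_eq v).symm
  have hle := hA Finset.univ (by simpa using hL)
  linarith

theorem normalize_mem_delocalizedSet_iff {v : EuclideanSpace ℝ (Fin N)} (hv : v ≠ 0) :
    NormedSpace.normalize v ∈ delocalizedSet N L κ ↔
      ∀ A : Finset (Fin N), A.card ≤ L → ∑ j ∈ A, v j ^ 2 ≤ κ ^ 2 * ‖v‖ ^ 2 := by
  have hnorm : NormedSpace.normalize v ∈ Metric.sphere 0 1 := by simp [hv]
  have hcoord (A : Finset (Fin N)) :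
      ∑ j ∈ A, |NormedSpace.normalize v j| ^ 2 = (∑ j ∈ A, v j ^ 2) / ‖v‖ ^ 2 := by
    simp only [NormedSpace.normalize, PiLp.smul_apply, smul_eq_mul, sq_abs, mul_pow, inv_pow,
      Finset.mul_sum, div_eq_inv_mul]
  have hpos : 0 < ‖v‖ ^ 2 := by positivity
  simp only [delocalizedSet, Set.mem_ofPred_eq, hnorm, true_and, hcoord, div_le_iff₀ hpos]

theorem normalize_mem_delocalizedSet (ht : 0 ≤ t) {v : EuclideanSpace ℝ (Fin N)} (hv : v ≠ 0)
    (hmass : L * t + ∑ j, tailSq t (v j) ≤ κ ^ 2 * ‖v‖ ^ 2) :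
    NormedSpace.normalize v ∈ delocalizedSet N L κ := by
  refine (normalize_mem_delocalizedSet_iff hv).2 fun A hA => ?_
  calc ∑ j ∈ A, v j ^ 2 ≤ ∑ j ∈ A, (t + tailSq t (v j)) := by
        gcongr with j
        exact sq_le_add_tailSq ht _
    _ = A.card * t + ∑ j ∈ A, tailSq t (v j) := by simp [Finset.sum_add_distrib]
    _ ≤ L * t + ∑ j, tailSq t (v j) := by
        gcongr
        · exact fun j _ _ => tailSq_nonneg t _
        · exact A.subset_univ
    _ ≤ κ ^ 2 * ‖v‖ ^ 2 := hmass

theorem normalize_notMem_delocalizedSet (ht : 0 ≤ t) {v : EuclideanSpace ℝ (Fin N)}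
    (htail : κ ^ 2 * ‖v‖ ^ 2 < ∑ j, tailSq t (v j)) (hcard : κ ^ 2 * ‖v‖ ^ 2 < (L - 1) * t) :
    NormedSpace.normalize v ∉ delocalizedSet N L κ := by
  rcases eq_or_ne v 0 with rfl | hv
  · simp [delocalizedSet]
  rw [normalize_mem_delocalizedSet_iff hv]
  push Not
  -- Either all large coordinates fit into a set of size `L`, or `⌊L⌋` of them are heavy enough.
  let B : Finset (Fin N) := {j | t < v j ^ 2}
  rcases le_or_gt (B.card : ℝ) L with hB | hB
  · refine ⟨B, hB, htail.trans_eq ?_⟩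
    simp [B, tailSq, Set.indicator_apply, Finset.sum_filter]
  · have hL : 0 ≤ L := by
      have := pos_of_mul_pos_left ((by positivity : 0 ≤ κ ^ 2 * ‖v‖ ^ 2).trans_lt hcard) ht
      linarith
    obtain ⟨A, hAB, hA⟩ := Finset.exists_subset_card_eq (Nat.floor_le_of_le hB.le)
    refine ⟨A, hA ▸ Nat.floor_le hL, hcard.trans_le ?_⟩
    calc (L - 1) * t ≤ A.card * t := by
          gcongr
          rw [hA]
          exact (Nat.sub_one_lt_floor L).le
      _ = ∑ _ ∈ A, t := by simp
      _ ≤ ∑ j ∈ A, v j ^ 2 :=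
          Finset.sum_le_sum fun _ hj => (Finset.mem_filter.1 (hAB hj)).2.le

end Delocalized

section Asymptotics

variable {x : ℕ → ℝ} {ν : ℕ → ℝ} {κ t ν₀ F : ℝ}

theorem eventually_initialVector_ne_zero
    (hsq : Tendsto (fun N : ℕ => (∑ i ∈ Finset.range N, x i ^ 2) / N) atTop (𝓝 1)) :
    ∀ᶠ N in atTop, initialVector N x ≠ 0 := by
  filter_upwards [hsq.eventually (lt_mem_nhds one_pos)] with N hN hzero
  simp [← norm_sq_initialVector, hzero] at hN

theorem eventually_normalize_initialVector_mem_delocalizedSet (ht : 0 ≤ t)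
    (hsq : Tendsto (fun N : ℕ => (∑ i ∈ Finset.range N, x i ^ 2) / N) atTop (𝓝 1))
    (htail : Tendsto (fun N : ℕ => (∑ i ∈ Finset.range N, tailSq t (x i)) / N) atTop (𝓝 F))
    (hκ : ν₀ * t + F < κ ^ 2) (hν : ∀ᶠ N in atTop, ν N ≤ ν₀) :
    ∀ᶠ N in atTop, NormedSpace.normalize (initialVector N x) ∈ delocalizedSet N (ν N * N) κ := by
  have hlim := (htail.const_add (ν₀ * t)).eventually_lt (hsq.const_mul (κ ^ 2)) (by simpa using hκ)
  filter_upwards [hlim, hν, eventually_gt_atTop 0, eventually_initialVector_ne_zero hsq]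
    with N hN hνN hpos hne
  refine normalize_mem_delocalizedSet ht hne ?_
  rw [norm_sq_initialVector, sum_initialVector]
  have hpos' : (0 : ℝ) < N := Nat.cast_pos.2 hpos
  field_simp at hN
  have : ν N * N * t ≤ ν₀ * N * t := by gcongr
  linarith

theorem eventually_normalize_initialVector_notMem_delocalizedSet (ht : 0 ≤ t)
    (hsq : Tendsto (fun N : ℕ => (∑ i ∈ Finset.range N, x i ^ 2) / N) atTop (𝓝 1))
    (htail : Tendsto (fun N : ℕ => (∑ i ∈ Finset.range N, tailSq t (x i)) / N) atTop (𝓝 F))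
    (hκF : κ ^ 2 < F) (hκν : κ ^ 2 < ν₀ * t) (hν : ∀ᶠ N in atTop, ν₀ ≤ ν N) :
    ∀ᶠ N in atTop, NormedSpace.normalize (initialVector N x) ∉ delocalizedSet N (ν N * N) κ := by
  have hmass := hsq.const_mul (κ ^ 2)
  have hlim₁ := hmass.eventually_lt htail (by simpa using hκF)
  have hlim₂ := hmass.eventually_lt
    ((tendsto_const_div_atTop_nhds_zero_nat t).const_sub (ν₀ * t)) (by simpa using hκν)
  filter_upwards [hlim₁, hlim₂, hν, eventually_gt_atTop 0] with N hN₁ hN₂ hνN hpos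
  have hpos' : (0 : ℝ) < N := Nat.cast_pos.2 hpos
  field_simp at hN₁ hN₂
  refine normalize_notMem_delocalizedSet ht ?_ ?_ <;> rw [norm_sq_initialVector]
  · rwa [sum_initialVector]
  · have : ν₀ * N * t ≤ ν N * N * t := by gcongr
    linarith

theorem uniformSphere_real_delocalizedSet {N : ℕ} (hN : 1 ≤ N) (L κ : ℝ) :
    (uniformSphere N).real (delocalizedSet N L κ) =
      (Measure.infinitePi fun _ : ℕ => gaussianReal 0 1).real
        {x | NormedSpace.normalize (initialVector N x) ∈ delocalizedSet N L κ} :=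
  ((hasLaw_normalize_initialVector hN).measureReal_eq
    (isClosed_delocalizedSet N L κ).measurableSet).symm

theorem measurableSet_normalize_initialVector_mem_delocalizedSet (N : ℕ) (L κ : ℝ) :
    MeasurableSet {x | NormedSpace.normalize (initialVector N x) ∈ delocalizedSet N L κ} :=
  (measurable_normalize.comp (measurable_initialVector N))
    (isClosed_delocalizedSet N L κ).measurableSet

theorem ae_tendsto_average_sq :
    ∀ᵐ x : ℕ → ℝ ∂(Measure.infinitePi fun _ : ℕ => gaussianReal 0 1),
      Tendsto (fun N : ℕ => (∑ i ∈ Finset.range N, x i ^ 2) / N) atTop (𝓝 1) := by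
  simpa [integral_sq_gaussianReal] using
    ae_tendsto_average_infinitePi (f := fun y : ℝ => y ^ 2) (by fun_prop)
      (integrable_sq_gaussianReal 0 1)

theorem ae_tendsto_average_tailSq (t : ℝ) :
    ∀ᵐ x : ℕ → ℝ ∂(Measure.infinitePi fun _ : ℕ => gaussianReal 0 1),
      Tendsto (fun N : ℕ => (∑ i ∈ Finset.range N, tailSq t (x i)) / N) atTop
        (𝓝 (∫ y, tailSq t y ∂(gaussianReal 0 1))) :=
  ae_tendsto_average_infinitePi (measurable_tailSq t)
    (integrable_tailSq (integrable_sq_gaussianReal 0 1) t)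

theorem tendsto_uniformSphere_real_delocalizedSet_one (ht : 0 ≤ t)
    (hκ : ν₀ * t + ∫ x, tailSq t x ∂(gaussianReal 0 1) < κ ^ 2)
    (hν : ∀ᶠ N in atTop, ν N ≤ ν₀) :
    Tendsto (fun N => (uniformSphere N).real (delocalizedSet N (ν N * N) κ)) atTop (𝓝 1) := by
  refine Tendsto.congr' ?_ (tendsto_measureReal_one_of_ae_eventually_mem
    (μ := Measure.infinitePi fun _ : ℕ => gaussianReal 0 1)
    (fun N => measurableSet_normalize_initialVector_mem_delocalizedSet N (ν N * N) κ) ?_)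
  · filter_upwards [eventually_ge_atTop 1] with N hN
    exact (uniformSphere_real_delocalizedSet hN _ κ).symm
  · filter_upwards [ae_tendsto_average_sq, ae_tendsto_average_tailSq t] with x hsq htail
    exact eventually_normalize_initialVector_mem_delocalizedSet ht hsq htail hκ hν

theorem tendsto_uniformSphere_real_delocalizedSet_zero (ht : 0 ≤ t)
    (hκF : κ ^ 2 < ∫ x, tailSq t x ∂(gaussianReal 0 1)) (hκν : κ ^ 2 < ν₀ * t)
    (hν : ∀ᶠ N in atTop, ν₀ ≤ ν N) :
    Tendsto (fun N => (uniformSphere N).real (delocalizedSet N (ν N * N) κ)) atTop (𝓝 0) := by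
  refine Tendsto.congr' ?_ (tendsto_measureReal_zero_of_ae_eventually_notMem
    (μ := Measure.infinitePi fun _ : ℕ => gaussianReal 0 1)
    (fun N => measurableSet_normalize_initialVector_mem_delocalizedSet N (ν N * N) κ) ?_)
  · filter_upwards [eventually_ge_atTop 1] with N hN
    exact (uniformSphere_real_delocalizedSet hN _ κ).symm
  · filter_upwards [ae_tendsto_average_sq, ae_tendsto_average_tailSq t] with x hsq htail
    exact eventually_normalize_initialVector_notMem_delocalizedSet ht hsq htail hκF hκν hν

theorem tendsto_uniformSphere_real_delocalizedSet_zero_of_one_le (hκ : κ ^ 2 < 1)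
    (hν : ∀ᶠ N in atTop, 1 ≤ ν N) :
    Tendsto (fun N => (uniformSphere N).real (delocalizedSet N (ν N * N) κ)) atTop (𝓝 0) := by
  refine tendsto_const_nhds.congr' ?_
  filter_upwards [hν] with N hN
  rw [delocalizedSet_eq_empty hκ (le_mul_of_one_le_left N.cast_nonneg hN), measureReal_empty]

end Asymptotics

section Constants

variable {κ : ℝ}

theorem one_lt_log_exp_one_div (hκ₀ : 0 < κ) (hκ₁ : κ < 1) : 1 < Real.log (Real.exp 1 / κ) := by
  rw [Real.log_div (Real.exp_ne_zero 1) hκ₀.ne', Real.log_exp]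
  linarith [Real.log_neg hκ₀ hκ₁]

theorem exp_neg_log_exp_one_div (hκ₀ : 0 < κ) :
    Real.exp (-Real.log (Real.exp 1 / κ)) = κ / Real.exp 1 := by
  rw [Real.exp_neg, Real.exp_log (by positivity), inv_div]

theorem integral_tailSq_log_exp_one_div_le (hκ₀ : 0 < κ) (hκ₁ : κ < 1) :
    ∫ x, tailSq (32 * Real.log (Real.exp 1 / κ)) x ∂(gaussianReal 0 1) ≤ κ ^ 2 / 2 := by
  set l := Real.log (Real.exp 1 / κ)
  have hexp : Real.exp (-(1 / 8 * (32 * l))) = κ ^ 4 / Real.exp 1 ^ 4 := by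
    calc Real.exp (-(1 / 8 * (32 * l))) = Real.exp ((4 : ℕ) * -l) := by
          congr 1
          push_cast
          ring
      _ = κ ^ 4 / Real.exp 1 ^ 4 := by
          rw [Real.exp_nat_mul, exp_neg_log_exp_one_div hκ₀, div_pow]
  have hsqrt : (√(1 - 4 * (1 / 8)))⁻¹ ≤ 2 :=
    inv_le_of_inv_le₀ two_pos (Real.le_sqrt_of_sq_le (by norm_num))
  have he4 : 32 ≤ Real.exp 1 ^ 4 := by
    calc (32 : ℝ) ≤ 2.5 ^ 4 := by norm_num
      _ ≤ Real.exp 1 ^ 4 := by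
          gcongr
          linarith [Real.exp_one_gt_d9]
  calc ∫ x, tailSq (32 * l) x ∂(gaussianReal 0 1)
      ≤ (1 / 8)⁻¹ * Real.exp (-(1 / 8 * (32 * l))) * (√(1 - 4 * (1 / 8)))⁻¹ :=
        integral_tailSq_gaussianReal_le (by norm_num) (by norm_num) _
    _ ≤ (1 / 8)⁻¹ * (κ ^ 2 / 32) * 2 := by
        rw [hexp]
        gcongr (1 / 8)⁻¹ * ?_ * ?_
        exact div_le_div₀ (by positivity) (pow_le_pow_of_le_one hκ₀.le hκ₁.le (by norm_num))
          (by norm_num) he4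
    _ = κ ^ 2 / 2 := by ring

theorem sq_lt_integral_tailSq_log_exp_one_div (hκ₀ : 0 < κ) (hκ₁ : κ < 1 / 27) :
    κ ^ 2 < ∫ x, tailSq (Real.log (Real.exp 1 / κ)) x ∂(gaussianReal 0 1) := by
  have hone := one_lt_log_exp_one_div hκ₀ (hκ₁.trans (by norm_num))
  set l := Real.log (Real.exp 1 / κ)
  have hexp : Real.exp (-(l + 1)) = κ / Real.exp 1 ^ 2 := by
    rw [neg_add, Real.exp_add, exp_neg_log_exp_one_div hκ₀, Real.exp_neg, sq, ← div_eq_mul_inv,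
      div_div]
  have he : Real.exp 1 ≤ 3 := Real.exp_one_lt_three.le
  calc κ ^ 2 < κ / 3 ^ 2 / 3 := by nlinarith
    _ ≤ κ / Real.exp 1 ^ 2 / 3 := by gcongr
    _ = Real.exp (-(l + 1)) / 3 := by rw [hexp]
    _ ≤ l * (Real.exp (-(l + 1)) / 3) := le_mul_of_one_le_left (by positivity) hone.le
    _ ≤ ∫ x, tailSq l x ∂(gaussianReal 0 1) :=
        mul_exp_neg_div_three_le_integral_tailSq_gaussianReal (by linarith)

theorem log_exp_one_div_le_mul_sq (hκ : 1 / 27 ≤ κ) :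
    Real.log (Real.exp 1 / κ) ≤ 3 ^ 10 * κ ^ 2 := by
  have : 0 < κ := by linarith
  calc Real.log (Real.exp 1 / κ) ≤ Real.exp 1 / κ := Real.log_le_self (by positivity)
    _ ≤ 3 / (1 / 27) := by
        gcongr
        exact Real.exp_one_lt_three.le
    _ = 3 ^ 10 * (1 / 27) ^ 2 := by norm_num
    _ ≤ 3 ^ 10 * κ ^ 2 := by gcongr

theorem tendsto_uniformSphere_real_delocalizedSet_one_of_le (hκ₀ : 0 < κ) (hκ₁ : κ < 1)
    {ν : ℕ → ℝ}
    (hν : ∀ᶠ N in atTop, ν N ≤ 1 / 128 * κ ^ 2 / Real.log (Real.exp 1 / κ)) :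
    Tendsto (fun N => (uniformSphere N).real (delocalizedSet N (ν N * N) κ)) atTop (𝓝 1) := by
  have hl := one_lt_log_exp_one_div hκ₀ hκ₁
  have htail := integral_tailSq_log_exp_one_div_le hκ₀ hκ₁
  set l := Real.log (Real.exp 1 / κ)
  refine tendsto_uniformSphere_real_delocalizedSet_one (t := 32 * l) (by positivity) ?_ hν
  have hsmall : 1 / 128 * κ ^ 2 / l * (32 * l) = κ ^ 2 / 4 := by
    field_simp
    norm_num
  linarith [pow_pos hκ₀ 2]

theorem tendsto_uniformSphere_real_delocalizedSet_zero_of_ge (hκ₀ : 0 < κ) (hκ₁ : κ < 1)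
    {ν : ℕ → ℝ} (hν : ∀ᶠ N in atTop, 3 ^ 10 * κ ^ 2 / Real.log (Real.exp 1 / κ) ≤ ν N) :
    Tendsto (fun N => (uniformSphere N).real (delocalizedSet N (ν N * N) κ)) atTop (𝓝 0) := by
  have hl : 0 < Real.log (Real.exp 1 / κ) := one_pos.trans (one_lt_log_exp_one_div hκ₀ hκ₁)
  rcases lt_or_ge κ (1 / 27) with hκ | hκ
  · refine tendsto_uniformSphere_real_delocalizedSet_zero hl.le
      (sq_lt_integral_tailSq_log_exp_one_div hκ₀ hκ) ?_ hν
    rw [div_mul_cancel₀ _ hl.ne']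
    linarith [pow_pos hκ₀ 2]
  · -- For `κ` bounded below, the constant `3 ^ 10` is so large that `1 ≤ ν N`.
    refine tendsto_uniformSphere_real_delocalizedSet_zero_of_one_le
      (pow_lt_one₀ hκ₀.le hκ₁ two_ne_zero) (hν.mono fun N hN => hN.trans' ?_)
    exact (one_le_div hl).2 (log_exp_one_div_le_mul_sq hκ)

end Constants

theorem mainTheorem2 :
    ∃ c₁ c₂ : ℝ, 0 < c₁ ∧ 0 < c₂ ∧
      ∀ κ : ℝ, 0 < κ → κ < 1 →
      ∀ (Ω : ℕ → Type*) [∀ N, MeasurableSpace (Ω N)]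
        (P : ∀ N, Measure (Ω N)) [∀ N, IsProbabilityMeasure (P N)]
        (V : ∀ N, Ω N → EuclideanSpace ℝ (Fin N)),
        (∀ N, 1 ≤ N → HasLaw (V N) (uniformSphere N) (P N)) →
      ∀ ν : ℕ → ℝ,
        ((∀ N, ν N ≤ c₁ * κ ^ 2 / Real.log (Real.exp 1 / κ)) →
          Tendsto (fun N => (P N).real {ω | V N ω ∈ delocalizedSet N (ν N * N) κ})
            atTop (𝓝 1)) ∧
        ((∀ N, c₂ * κ ^ 2 / Real.log (Real.exp 1 / κ) ≤ ν N) →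
          Tendsto (fun N => (P N).real {ω | V N ω ∈ delocalizedSet N (ν N * N) κ})
            atTop (𝓝 0)) := by
  refine ⟨1 / 128, 3 ^ 10, by norm_num, by norm_num, fun κ hκ₀ hκ₁ Ω _ P _ V hV ν => ?_⟩
  have hlaw : ∀ᶠ N in atTop, (uniformSphere N).real (delocalizedSet N (ν N * N) κ) =
      (P N).real {ω | V N ω ∈ delocalizedSet N (ν N * N) κ} := by
    filter_upwards [eventually_ge_atTop 1] with N hN
    exact ((hV N hN).measureReal_eq (isClosed_delocalizedSet N _ κ).measurableSet).symm
  exact ⟨fun hν => (tendsto_uniformSphere_real_delocalizedSet_one_of_le hκ₀ hκ₁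
      (.of_forall hν)).congr' hlaw,
    fun hν => (tendsto_uniformSphere_real_delocalizedSet_zero_of_ge hκ₀ hκ₁
      (.of_forall hν)).congr' hlaw⟩
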